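/- Let $d\ge 1$, let $\sigma$ be a permutation of $\{1,\dots,d\}$, let $\theta\in(\mathbf R\setminus\{0\})^d$, and let $\Lambda=\{(\theta_1j_1,\dots,\theta_dj_d): j\in\mathbf Z^d\}$. Let $\omega_1,\omega_2$ be positive functions on $\Lambda$ and $\omega_0$ a positive function on $\Lambda\times\Lambda$ such that $$\frac{\omega_2(j)}{\omega_1(k)}\le\omega_0(j,k),\qquad j,k\in\Lambda .$$ For $\boldsymbol p=(p_1,\dots,p_d)\in(0,\infty]^d$ and a positive function $\omega$ on $\Lambda$, let $\ell^{\boldsymbol p}_{\sigma,(\omega)}(\Lambda)$ be the space of all $f:\Lambda\to\mathbf C$ with finite mixed quasi-norm, obtained from $|f\omega|(x_{\sigma^{-1}(1)},\dots,x_{\sigma^{-1}(d)})$ by taking successively the $\ell^{p_1}$ quasi-norm in $x_1$, the $\ell^{p_2}$ quasi-norm in $x_2$, and so on up to $x_d$ ($x_k$ runs through $\theta_{\sigma(k)}\mathbf Z$), with the topology of this quasi-norm. Let $\ell_0(\Lambda)$ be the space of finitely supported sequences. For $p,q\in(0,\infty]$ let $\mathbb U^{p,q}(\omega_0,\Lambda)$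 be the set of complex matrices $A=(a(j,k))_{j,k\in\Lambda}$ such that $$\|A\|_{\mathbb U^{p,q}(\omega_0,\Lambda)}=\|h\|_{\ell^q(\Lambda)}<\infty,\qquad h(k)=\|a(\cdot,\cdot-k)\,\omega_0(\cdot,\cdot-k)\|_{\ell^p(\Lambda)} .$$ **Theorem.** Let $\boldsymbol p_1,\boldsymbol p_2\in(0,\infty]^d$ and $p,q\in(0,\infty]$ be such that $$\frac1{\boldsymbol p_2}-\frac1{\boldsymbol p_1}=\frac1p+\min\Big(0,\frac1q-1\Big)\ \text{ (in every component)},\qquad q\le\min(\boldsymbol p_2)\le\max(\boldsymbol p_2)\le p,$$ with $1/\infty=0$, and let $A\in\mathbb U^{p,q}(\omega_0,\Lambda)$. Then $\ell_0(\Lambda)\subseteq\ell^{\boldsymbol p_1}_{\sigma,(\omega_1)}(\Lambda)$, and the map $f\mapsto Af$, $(Af)(j)=\sum_k a(j,k)f(k)$, from $\ell_0(\Lambda)$ to the space of all complex sequences on $\Lambda$ extends to a continuous linear map $$T:\ell^{\boldsymbol p_1}_{\sigma,(\omega_1)}(\Lambda)\to\ell^{\boldsymbol p_2}_{\sigma,(\omega_2)}(\Lambda),$$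 whose values are given by the absolutely convergent series $(Tf)(j)=\sum_k a(j,k)f(k)$, and whose operator quasi-norm (the least $C\in[0,\infty]$ with $\|Tf\|\le C\|f\|$ for all $f$) satisfies $$\|T\|\le\|A\|_{\mathbb U^{p,q}(\omega_0,\Lambda)} .$$ The extension is unique in the following sense. If $\max(\boldsymbol p_1)<\infty$, then $T$ is the only continuous map that extends $A$ from $\ell_0(\Lambda)$. In general, $T$ has the property that $Tf_n\to Tf$ pointwise on $\Lambda$ whenever $f_n,f\in\ell^{\boldsymbol p_1}_{\sigma,(\omega_1)}(\Lambda)$ satisfy $|f_n|\le|f|$ and $f_n\to f$ pointwise on $\Lambda$, and $T$ is the only continuous extension of $A$ with this property. -/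

import Mathlib

open MeasureTheory Filter Topology
open scoped ENNReal NNReal

noncomputable section

/-- The lattice `Λ = T_θ ℤ^d = {(θ₁ j₁, …, θ_d j_d) : j ∈ ℤ^d}`, as a subgroup of `ℝ^d`. -/
def lattice {d : ℕ} (θ : Fin d → ℝ) : AddSubgroup (Fin d → ℝ) where
  carrier := {x | ∃ n : Fin d → ℤ, x = fun i => θ i * (n i : ℝ)}
  zero_mem' := ⟨0, by funext i; simp⟩
  add_mem' := by
    rintro _ _ ⟨m, rfl⟩ ⟨n, rfl⟩
    exact ⟨m + n, by funext i; simp [mul_add]⟩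
  neg_mem' := by
    rintro _ ⟨n, rfl⟩
    exact ⟨-n, by funext i; simp⟩

/-- The lattice point `T_θ n`. -/
def latticePoint {d : ℕ} (θ : Fin d → ℝ) (n : Fin d → ℤ) : lattice θ :=
  ⟨fun i => θ i * (n i : ℝ), n, rfl⟩

/-- The `ℓ^p` quasi-norm (`0 < p ≤ ∞`) of an extended nonnegative function:
the `L^p` quasi-norm for the counting measure, with value `∞` allowed. -/
def seqNorm {ι : Type*} (p : ℝ≥0∞) (g : ι → ℝ≥0∞) : ℝ≥0∞ :=
  @eLpNorm ι ℝ≥0∞ _ ⊤ g p (@Measure.count ι ⊤)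

/-- The iterated mixed quasi-norm of `g = g(n₁, …, n_d)` on `ℤ^d`: first the `ℓ^{p₁}` quasi-norm in
the variable `n₁`, then the `ℓ^{p₂}` quasi-norm in `n₂`, and so on. -/
def mixedNorm : {d : ℕ} → (Fin d → ℝ≥0∞) → ((Fin d → ℤ) → ℝ≥0∞) → ℝ≥0∞
  | 0, _, g => g Fin.elim0
  | _ + 1, p, g =>
      mixedNorm (Fin.tail p) (fun y => seqNorm (p 0) (fun t : ℤ => g (Fin.cons t y)))

/-- The weighted mixed quasi-norm on sequences on `Λ`.  The function
`g₀(x₁, …, x_d) = |f ω|(x_{σ⁻¹(1)}, …, x_{σ⁻¹(d)})` is measured successively in `x₁, …, x_d`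
with exponents `p₁, …, p_d`.  The variable `x_k` runs through `θ_{σ(k)} ℤ`, and is parametrized by
`x_k = θ_{σ(k)} n_k`, `n_k ∈ ℤ`. -/
def latticeNorm {d : ℕ} (σ : Equiv.Perm (Fin d)) (θ : Fin d → ℝ) (p : Fin d → ℝ≥0∞)
    (ω : lattice θ → ℝ) (f : lattice θ → ℂ) : ℝ≥0∞ :=
  mixedNorm p (fun n => ‖f (latticePoint θ (n ∘ σ.symm)) * (ω (latticePoint θ (n ∘ σ.symm)) : ℂ)‖ₑ)

theorem seqNorm_mono {ι : Type*} (p : ℝ≥0∞) {g h : ι → ℝ≥0∞} (H : ∀ i, g i ≤ h i) :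
    seqNorm p g ≤ seqNorm p h := by
  let _ : MeasurableSpace ι := ⊤
  exact eLpNorm_mono_enorm (fun i => by simpa using H i)

theorem seqNorm_add_le (p : ℝ≥0∞) (g h : ℤ → ℝ≥0∞) :
    seqNorm p (fun i => g i + h i) ≤ ENNReal.LpAddConst p * (seqNorm p g + seqNorm p h) := by
  let _ : MeasurableSpace ℤ := ⊤
  exact eLpNorm_add_le' (measurable_of_countable g).aestronglyMeasurable
    (measurable_of_countable h).aestronglyMeasurable p

theorem seqNorm_smul_le (p : ℝ≥0∞) (c : ℝ≥0) (g : ℤ → ℝ≥0∞) :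
    seqNorm p (fun i => (c : ℝ≥0∞) * g i) ≤ c * seqNorm p g := by
  let _ : MeasurableSpace ℤ := ⊤
  have h := eLpNorm_le_nnreal_smul_eLpNorm_of_ae_le_mul' (μ := (Measure.count : Measure ℤ))
    (f := fun i => (c : ℝ≥0∞) * g i) (g := g) (c := c)
    (Filter.Eventually.of_forall fun i => by simp) p
  exact h.trans_eq (ENNReal.smul_def _ _)

theorem mixedNorm_mono : ∀ {d : ℕ} (p : Fin d → ℝ≥0∞) {g h : (Fin d → ℤ) → ℝ≥0∞},
    (∀ n, g n ≤ h n) → mixedNorm p g ≤ mixedNorm p h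
  | 0, _, _, _, H => H _
  | _ + 1, p, _, _, H =>
      mixedNorm_mono (Fin.tail p) fun _ => seqNorm_mono _ fun _ => H _

theorem mixedNorm_smul_le : ∀ {d : ℕ} (p : Fin d → ℝ≥0∞) (c : ℝ≥0) (g : (Fin d → ℤ) → ℝ≥0∞),
    mixedNorm p (fun n => (c : ℝ≥0∞) * g n) ≤ c * mixedNorm p g
  | 0, _, _, _ => le_rfl
  | _ + 1, p, c, _ =>
      (mixedNorm_mono (Fin.tail p) fun _ => seqNorm_smul_le _ c _).trans
        (mixedNorm_smul_le (Fin.tail p) c _)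

theorem mixedNorm_add_le : ∀ {d : ℕ} (p : Fin d → ℝ≥0∞),
    ∃ C : ℝ≥0, ∀ g h : (Fin d → ℤ) → ℝ≥0∞,
      mixedNorm p (fun n => g n + h n) ≤ C * (mixedNorm p g + mixedNorm p h)
  | 0, _ => ⟨1, fun _ _ => by simp [mixedNorm]⟩
  | _ + 1, p => by
      obtain ⟨C, hC⟩ := mixedNorm_add_le (Fin.tail p)
      have hK : ((ENNReal.LpAddConst (p 0)).toNNReal : ℝ≥0∞) = ENNReal.LpAddConst (p 0) :=
        ENNReal.coe_toNNReal (ENNReal.LpAddConst_lt_top (p 0)).ne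
      refine ⟨(ENNReal.LpAddConst (p 0)).toNNReal * C, fun g h => ?_⟩
      refine (mixedNorm_mono (Fin.tail p) fun y =>
        seqNorm_add_le (p 0) (fun t => g (Fin.cons t y)) (fun t => h (Fin.cons t y))).trans ?_
      rw [← hK]
      refine (mixedNorm_smul_le (Fin.tail p) _ _).trans ?_
      rw [ENNReal.coe_mul, mul_assoc]
      exact mul_le_mul_right (hC _ _) _

theorem mixedNorm_zero : ∀ {d : ℕ} (p : Fin d → ℝ≥0∞), mixedNorm p (fun _ => 0) = 0 := by
  intro d p
  have h := mixedNorm_smul_le p 0 (fun _ => 0)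
  simpa using h

/-- The space `ℓ^p_{σ,(ω)}(Λ)` as a linear subspace of the space `ℓ(Λ)` of all complex
sequences on `Λ`. -/
def mixedSubmodule {d : ℕ} (σ : Equiv.Perm (Fin d)) (θ : Fin d → ℝ) (p : Fin d → ℝ≥0∞)
    (ω : lattice θ → ℝ) : Submodule ℂ (lattice θ → ℂ) where
  carrier := {f | latticeNorm σ θ p ω f < ∞}
  zero_mem' := by
    simp [latticeNorm, mixedNorm_zero]
  add_mem' := by
    intro f g hf hg
    obtain ⟨C, hC⟩ := mixedNorm_add_le p
    refine lt_of_le_of_lt ((mixedNorm_mono p fun n => ?_).trans (hC _ _))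
      (ENNReal.mul_lt_top ENNReal.coe_lt_top (ENNReal.add_lt_top.2 ⟨hf, hg⟩))
    rw [Pi.add_apply, add_mul]
    exact enorm_add_le _ _
  smul_mem' := by
    intro c f hf
    refine lt_of_le_of_lt ((mixedNorm_mono p fun n => ?_).trans (mixedNorm_smul_le p ‖c‖₊ _))
      (ENNReal.mul_lt_top ENNReal.coe_lt_top hf)
    rw [Pi.smul_apply, smul_eq_mul, mul_assoc, enorm_mul]
    exact le_rfl

/-- The quasi-normed space `ℓ^p_{σ,(ω)}(Λ)`.  This is a type of its own, so that it carries the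
topology of its quasi-norm and not the topology of pointwise convergence. -/
def MixedSeq {d : ℕ} (σ : Equiv.Perm (Fin d)) (θ : Fin d → ℝ) (p : Fin d → ℝ≥0∞)
    (ω : lattice θ → ℝ) : Type :=
  mixedSubmodule σ θ p ω

namespace MixedSeq

variable {d : ℕ} {σ : Equiv.Perm (Fin d)} {θ : Fin d → ℝ} {p : Fin d → ℝ≥0∞} {ω : lattice θ → ℝ}

instance : AddCommGroup (MixedSeq σ θ p ω) :=
  inferInstanceAs (AddCommGroup (mixedSubmodule σ θ p ω))

instance : Module ℂ (MixedSeq σ θ p ω) :=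
  inferInstanceAs (Module ℂ (mixedSubmodule σ θ p ω))

/-- The underlying sequence. -/
def toFun (f : MixedSeq σ θ p ω) : lattice θ → ℂ := f.1

instance : CoeFun (MixedSeq σ θ p ω) (fun _ => lattice θ → ℂ) := ⟨toFun⟩

/-- The quasi-norm of an element of `ℓ^p_{σ,(ω)}(Λ)`; it is finite. -/
def qnorm (f : MixedSeq σ θ p ω) : ℝ≥0∞ := latticeNorm σ θ p ω f

/-- The quasi-norm topology: a set is open when it contains, with each of its points, a
quasi-norm ball of positive radius around that point. -/
instance : TopologicalSpace (MixedSeq σ θ p ω) where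
  IsOpen U := ∀ f ∈ U, ∃ ε : ℝ≥0∞, 0 < ε ∧ ∀ g : MixedSeq σ θ p ω, qnorm (g - f) < ε → g ∈ U
  isOpen_univ := fun _ _ => ⟨1, one_pos, fun _ _ => trivial⟩
  isOpen_inter := by
    rintro U V hU hV f ⟨hfU, hfV⟩
    obtain ⟨ε, hε, h⟩ := hU f hfU
    obtain ⟨δ, hδ, h'⟩ := hV f hfV
    exact ⟨min ε δ, lt_min hε hδ, fun g hg =>
      ⟨h g (hg.trans_le (min_le_left _ _)), h' g (hg.trans_le (min_le_right _ _))⟩⟩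
  isOpen_sUnion := by
    rintro S hS f ⟨U, hU, hf⟩
    obtain ⟨ε, hε, h⟩ := hS U hU f hf
    exact ⟨ε, hε, fun g hg => ⟨U, hU, h g hg⟩⟩

/-- The operator quasi-norm of `T`: the least `C` with `‖T f‖ ≤ C ‖f‖` for all `f`. -/
def opNorm {p₁ p₂ : Fin d → ℝ≥0∞} {ω₁ ω₂ : lattice θ → ℝ}
    (T : MixedSeq σ θ p₁ ω₁ →L[ℂ] MixedSeq σ θ p₂ ω₂) : ℝ≥0∞ :=
  sInf {C : ℝ≥0∞ | ∀ f, qnorm (T f) ≤ C * qnorm f}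

end MixedSeq

/-- `‖A‖_{U^{p,q}(ω,Λ)} = ‖h‖_{ℓ^q(Λ)}` where `h(k)` is the `ℓ^p(Λ)` quasi-norm of
`j ↦ a(j, j - k) ω(j, j - k)`. -/
def uNorm {d : ℕ} (θ : Fin d → ℝ) (p q : ℝ≥0∞) (ω : lattice θ → lattice θ → ℝ)
    (A : Matrix (lattice θ) (lattice θ) ℂ) : ℝ≥0∞ :=
  seqNorm q (fun k : lattice θ =>
    seqNorm p (fun j : lattice θ => ‖A j (j - k) * (ω j (j - k) : ℂ)‖ₑ))

/-- The class `U^{p,q}(ω,Λ)` of matrices with finite quasi-norm. -/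
def uClass {d : ℕ} (θ : Fin d → ℝ) (p q : ℝ≥0∞) (ω : lattice θ → lattice θ → ℝ) :
    Set (Matrix (lattice θ) (lattice θ) ℂ) :=
  {A | uNorm θ p q ω A < ∞}

/-- The map `S` from `ℓ^{p₁}_{σ,(ω₁)}(Λ)` to `ℓ^{p₂}_{σ,(ω₂)}(Λ)` extends the map
`f ↦ A f`, `(A f)(j) = ∑_k a(j,k) f(k)` (a finite sum), defined on the space `ℓ₀(Λ)` of sequences
with finite support. -/
def Extends {d : ℕ} {σ : Equiv.Perm (Fin d)} {θ : Fin d → ℝ} {p₁ p₂ : Fin d → ℝ≥0∞}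
    {ω₁ ω₂ : lattice θ → ℝ} (A : Matrix (lattice θ) (lattice θ) ℂ)
    (S : MixedSeq σ θ p₁ ω₁ → MixedSeq σ θ p₂ ω₂) : Prop :=
  ∀ f : lattice θ → ℂ, f.support.Finite →
    ∃ hf : f ∈ mixedSubmodule σ θ p₁ ω₁, ∀ j, S ⟨f, hf⟩ j = ∑ᶠ k, A j k * f k

/-- Continuity of `S` under dominated pointwise convergence: if `|f_n| ≤ |f|` and `f_n → f`
pointwise on `Λ`, then `S f_n → S f` pointwise on `Λ`. -/
def DominatedContinuous {d : ℕ} {σ : Equiv.Perm (Fin d)} {θ : Fin d → ℝ} {p₁ p₂ : Fin d → ℝ≥0∞}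
    {ω₁ ω₂ : lattice θ → ℝ} (S : MixedSeq σ θ p₁ ω₁ → MixedSeq σ θ p₂ ω₂) : Prop :=
  ∀ (u : ℕ → MixedSeq σ θ p₁ ω₁) (f : MixedSeq σ θ p₁ ω₁),
    (∀ n k, ‖u n k‖ ≤ ‖f k‖) → (∀ k, Tendsto (fun n => u n k) atTop (𝓝 (f k))) →
      ∀ j, Tendsto (fun n => S (u n) j) atTop (𝓝 (S f j))

end

/-! ### `ℓ^p` quasi-norms for `0 < p ≤ ∞` -/

section SeqNorm

variable {ι κ : Type*}

/-! Replacing `k` by `j - k` in `∑ₖ a(j,k) f(k)` and using the weight condition bounds `|Af| ω₂` by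
a twisted convolution `∑ₖ B(j,k) F(j-k)` with `B(j,k) = |a ω₀|(j,j-k)` and `F = |f ω₁|`. Everything
rests on a Young inequality for such sums.

In one variable and for `q ≥ 1` it is Hölder's inequality with four factors
(`seqNorm_twisted_conv_le`). Several variables follow by induction
(`mixedNorm_twisted_conv_le_of_one_le`): the first variable is estimated for fixed remaining ones,
and `q ≤ p` allows the norms of `B` to be reordered by Minkowski's inequality. For `q ≤ 1`, the
bound `(∑ x)^q ≤ ∑ x^q` reduces to `q = 1` with all exponents divided by `q`
(`mixedNorm_twisted_conv_le`).

Applied to absolute values, the estimate gives absolute convergence and the norm bound together.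
Uniqueness comes from truncating `f` to finite sets: truncations converge in quasi-norm when all
exponents of the domain are finite, and in every case pointwise under the majorant `|f|`. -/

theorem seqNorm_top (g : ι → ℝ≥0∞) : seqNorm ∞ g = ⨆ i, g i := by
  let _ : MeasurableSpace ι := ⊤
  unfold seqNorm
  rw [eLpNorm_exponent_top, eLpNormEssSup_eq_essSup_enorm]
  simp only [enorm_eq_self]
  refine le_antisymm (essSup_le_of_ae_le _ (Eventually.of_forall fun i => le_iSup g i)) ?_
  refine iSup_le fun i => ?_
  -- Only the empty set is null for counting measure, so an almost everywhere bound holds at `i`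
  -- itself.
  by_contra! hlt
  have h := ae_lt_of_essSup_lt hlt
  rw [ae_iff, Measure.count_eq_zero_iff] at h
  have : i ∈ {a | ¬ g a < g i} := by simp
  rw [h] at this
  exact this

theorem seqNorm_eq_tsum {p : ℝ≥0∞} (h0 : 0 < p) (h1 : p ≠ ∞) (g : ι → ℝ≥0∞) :
    seqNorm p g = (∑' i, g i ^ p.toReal) ^ (1 / p.toReal) := by
  let _ : MeasurableSpace ι := ⊤
  unfold seqNorm
  rw [eLpNorm_eq_lintegral_rpow_enorm_toReal h0.ne' h1, lintegral_count]
  simp only [enorm_eq_self]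

theorem seqNorm_rpow_toReal {p : ℝ≥0∞} (h0 : 0 < p) (h1 : p ≠ ∞) (g : ι → ℝ≥0∞) :
    seqNorm p g ^ p.toReal = ∑' i, g i ^ p.toReal := by
  have hp : p.toReal ≠ 0 := (ENNReal.toReal_pos h0.ne' h1).ne'
  rw [seqNorm_eq_tsum h0 h1, ← ENNReal.rpow_mul, one_div_mul_cancel hp, ENNReal.rpow_one]

theorem seqNorm_one (g : ι → ℝ≥0∞) : seqNorm 1 g = ∑' i, g i := by
  simp [seqNorm_eq_tsum one_pos ENNReal.one_ne_top]

theorem seqNorm_le_iff {p : ℝ≥0∞} (h0 : 0 < p) (h1 : p ≠ ∞) {g : ι → ℝ≥0∞} {C : ℝ≥0∞} :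
    seqNorm p g ≤ C ↔ ∑' i, g i ^ p.toReal ≤ C ^ p.toReal := by
  have hp : 0 < p.toReal := ENNReal.toReal_pos h0.ne' h1
  rw [← seqNorm_rpow_toReal h0 h1, ENNReal.rpow_le_rpow_iff hp]

theorem le_seqNorm {p : ℝ≥0∞} (h0 : 0 < p) (g : ι → ℝ≥0∞) (i : ι) : g i ≤ seqNorm p g := by
  by_cases h1 : p = ∞
  · subst h1
    rw [seqNorm_top]
    exact le_iSup g i
  · have hp : 0 < p.toReal := ENNReal.toReal_pos h0.ne' h1
    rw [← ENNReal.rpow_le_rpow_iff hp, seqNorm_rpow_toReal h0 h1]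
    exact ENNReal.le_tsum (f := fun i => g i ^ p.toReal) i

theorem seqNorm_zero {p : ℝ≥0∞} : seqNorm p (fun _ : ι => 0) = 0 := by
  let _ : MeasurableSpace ι := ⊤
  exact eLpNorm_zero'

theorem seqNorm_equiv {p : ℝ≥0∞} (h0 : 0 < p) (e : ι ≃ κ) (g : κ → ℝ≥0∞) :
    seqNorm p (fun i => g (e i)) = seqNorm p g := by
  by_cases h1 : p = ∞
  · subst h1
    rw [seqNorm_top, seqNorm_top]
    exact e.iSup_comp (g := g)
  · rw [seqNorm_eq_tsum h0 h1, seqNorm_eq_tsum h0 h1]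
    congr 1
    exact e.tsum_eq (fun k => g k ^ p.toReal)

/-- Lower semicontinuity of the `ℓ^p` quasi-norm under pointwise convergence. -/
theorem seqNorm_le_of_tendsto {α : Type*} {l : Filter α} [l.NeBot] {p : ℝ≥0∞} (h0 : 0 < p)
    {u : α → ι → ℝ≥0∞} {g : ι → ℝ≥0∞} {C : ℝ≥0∞} (hu : ∀ i, Tendsto (fun a => u a i) l (𝓝 (g i)))
    (hC : ∀ a, seqNorm p (u a) ≤ C) : seqNorm p g ≤ C := by
  by_cases h1 : p = ∞
  · subst h1
    rw [seqNorm_top]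
    exact iSup_le fun i => le_of_tendsto (hu i)
      (Eventually.of_forall fun a => (le_seqNorm h0 (u a) i).trans (hC a))
  · rw [seqNorm_le_iff h0 h1]
    refine ENNReal.summable.tsum_le_of_sum_le fun s => ?_
    refine le_of_tendsto (tendsto_finsetSum s fun i _ =>
      ((ENNReal.continuous_rpow_const (y := p.toReal)).tendsto _).comp (hu i))
      (Eventually.of_forall fun a => ?_)
    exact (ENNReal.sum_le_tsum s).trans ((seqNorm_le_iff h0 h1).1 (hC a))

theorem seqNorm_add_le_of_one_le [Countable ι] {p : ℝ≥0∞} (hp : 1 ≤ p) (g h : ι → ℝ≥0∞) :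
    seqNorm p (fun i => g i + h i) ≤ seqNorm p g + seqNorm p h := by
  let _ : MeasurableSpace ι := ⊤
  exact eLpNorm_add_le (measurable_of_countable g).aestronglyMeasurable
    (measurable_of_countable h).aestronglyMeasurable hp

/-- Minkowski's inequality for infinite sums. -/
theorem seqNorm_tsum_le [Countable ι] {p : ℝ≥0∞} (hp : 1 ≤ p) (c : ι → κ → ℝ≥0∞) :
    seqNorm p (fun i => ∑' k, c i k) ≤ ∑' k, seqNorm p (fun i => c i k) := by
  have h0 : 0 < p := one_pos.trans_le hp
  refine seqNorm_le_of_tendsto h0 (l := atTop) (u := fun s i => ∑ k ∈ s, c i k)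
    (fun i => ENNReal.summable.hasSum) fun s => ?_
  refine le_trans ?_ (ENNReal.sum_le_tsum s)
  classical
  induction s using Finset.induction_on with
  | empty => simp [seqNorm_zero]
  | insert k s hk ih =>
    simp only [Finset.sum_insert hk]
    exact (seqNorm_add_le_of_one_le hp _ _).trans (add_le_add_right ih _)

theorem seqNorm_rpow {p : ℝ≥0∞} (h0 : 0 < p) {r : ℝ≥0} (hr : 0 < r) (g : ι → ℝ≥0∞) :
    seqNorm p (fun i => g i ^ (r : ℝ)) = seqNorm (p * r) g ^ (r : ℝ) := by
  have hr' : (0 : ℝ) < r := hr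
  have hr0 : (r : ℝ≥0∞) ≠ 0 := by exact_mod_cast hr.ne'
  by_cases h1 : p = ∞
  · subst h1
    rw [ENNReal.top_mul hr0, seqNorm_top, seqNorm_top]
    exact ((ENNReal.orderIsoRpow r hr').map_iSup g).symm
  · have hp : p.toReal ≠ 0 := (ENNReal.toReal_pos h0.ne' h1).ne'
    rw [seqNorm_eq_tsum h0 h1, seqNorm_eq_tsum (ENNReal.mul_pos h0.ne' hr0)
      (ENNReal.mul_ne_top h1 ENNReal.coe_ne_top), ← ENNReal.rpow_mul]
    simp only [← ENNReal.rpow_mul, ENNReal.toReal_mul, ENNReal.coe_toReal]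
    congr 1
    · simp only [mul_comm]
    · field_simp

theorem seqNorm_const_mul {p : ℝ≥0∞} (h0 : 0 < p) (c : ℝ≥0∞) (g : ι → ℝ≥0∞) :
    seqNorm p (fun i => c * g i) = c * seqNorm p g := by
  by_cases h1 : p = ∞
  · subst h1
    rw [seqNorm_top, seqNorm_top, ENNReal.mul_iSup]
  · have hp : 0 < p.toReal := ENNReal.toReal_pos h0.ne' h1
    rw [seqNorm_eq_tsum h0 h1, seqNorm_eq_tsum h0 h1]
    simp only [ENNReal.mul_rpow_of_nonneg _ _ hp.le]
    rw [ENNReal.tsum_mul_left, ENNReal.mul_rpow_of_nonneg _ _ (by positivity), ← ENNReal.rpow_mul,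
      mul_one_div_cancel hp.ne', ENNReal.rpow_one]

/-- Minkowski's inequality for mixed norms: interchanging `ℓ^p` and `ℓ^q` for `q ≤ p`. -/
theorem seqNorm_seqNorm_le [Countable ι] {p q : ℝ≥0∞} (hq : 0 < q) (hqp : q ≤ p)
    (c : ι → κ → ℝ≥0∞) :
    seqNorm p (fun i => seqNorm q (fun k => c i k)) ≤
      seqNorm q (fun k => seqNorm p (fun i => c i k)) := by
  have hp : 0 < p := hq.trans_le hqp
  by_cases hq' : q = ∞
  · have hp' : p = ∞ := top_le_iff.1 (hq' ▸ hqp)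
    subst hq' hp'
    simp only [seqNorm_top]
    exact (iSup_comm).le
  lift q to ℝ≥0 using hq'
  have hq0 : (0 : ℝ≥0) < q := by exact_mod_cast hq
  have hqr : (0 : ℝ) < q := hq0
  -- Taking `q`-th powers turns the `ℓ^q` norms into sums and `ℓ^p` into `ℓ^{p/q}`; since `p / q ≥
  -- 1`, Minkowski's inequality for sums applies.
  have hpq : 1 ≤ p / q := by
    rw [ENNReal.le_div_iff_mul_le (Or.inl hq.ne') (Or.inl ENNReal.coe_ne_top), one_mul]
    exact hqp
  have hmul : p / q * q = p := ENNReal.div_mul_cancel hq.ne' ENNReal.coe_ne_top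
  have h1 : ∀ g : ι → ℝ≥0∞, seqNorm p g ^ (q : ℝ) = seqNorm (p / q) (fun i => g i ^ (q : ℝ)) := by
    intro g
    rw [seqNorm_rpow (one_pos.trans_le hpq) hq0, hmul]
  rw [← ENNReal.rpow_le_rpow_iff hqr, h1]
  have h2 : ∀ g : κ → ℝ≥0∞, seqNorm q g ^ (q : ℝ) = ∑' k, g k ^ (q : ℝ) := fun g => by
    simpa using seqNorm_rpow_toReal hq ENNReal.coe_ne_top g
  simp only [h2, h1]
  exact seqNorm_tsum_le hpq _

/-- The interchange of `ℓ^1` and `ℓ^q` is applied to the diagonal matrix with entries `g i`. -/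
theorem tsum_le_seqNorm [Countable ι] {q : ℝ≥0∞} (hq : 0 < q) (hq1 : q ≤ 1) (g : ι → ℝ≥0∞) :
    ∑' i, g i ≤ seqNorm q g := by
  classical
  have h := seqNorm_seqNorm_le hq hq1 fun i k : ι => if i = k then g i else 0
  simp only [seqNorm_one, tsum_ite_eq] at h
  refine (ENNReal.tsum_le_tsum fun i => ?_).trans h
  simpa using le_seqNorm hq (fun k => if i = k then g i else 0) i

theorem seqNorm_prod {p : ℝ≥0∞} (h0 : 0 < p) (g : ι × κ → ℝ≥0∞) :
    seqNorm p g = seqNorm p (fun i => seqNorm p (fun k => g (i, k))) := by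
  by_cases h1 : p = ∞
  · subst h1
    simp only [seqNorm_top, iSup_prod]
  · rw [seqNorm_eq_tsum h0 h1, seqNorm_eq_tsum h0 h1]
    simp only [seqNorm_rpow_toReal h0 h1]
    congr 1
    exact ENNReal.summable.tsum_prod' fun _ => ENNReal.summable

theorem seqNorm_cons {p : ℝ≥0∞} (h0 : 0 < p) {d : ℕ} (g : (Fin (d + 1) → ℤ) → ℝ≥0∞) :
    seqNorm p g =
      seqNorm p (fun y : Fin d → ℤ => seqNorm p (fun t : ℤ => g (Fin.cons t y))) := by
  rw [← seqNorm_prod h0 (fun z : (Fin d → ℤ) × ℤ => g (Fin.cons z.2 z.1)),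
    ← seqNorm_equiv h0 ((Equiv.prodComm _ _).trans (Fin.consEquiv fun _ : Fin (d + 1) => ℤ)) g]
  rfl

/-- Dominated convergence in `ℓ^p`, `p < ∞`. -/
theorem tendsto_seqNorm_zero {p : ℝ≥0∞} (h0 : 0 < p) (h1 : p ≠ ∞) {u : ℕ → ι → ℝ≥0∞}
    {g : ι → ℝ≥0∞} (hug : ∀ n i, u n i ≤ g i) (hg : seqNorm p g ≠ ∞)
    (hu : ∀ i, Tendsto (fun n => u n i) atTop (𝓝 0)) :
    Tendsto (fun n => seqNorm p (u n)) atTop (𝓝 0) := by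
  let _ : MeasurableSpace ι := ⊤
  have hp : 0 < p.toReal := ENNReal.toReal_pos h0.ne' h1
  simp only [seqNorm_eq_tsum h0 h1]
  have key : Tendsto (fun n => ∑' i, u n i ^ p.toReal) atTop (𝓝 0) := by
    have := tendsto_lintegral_of_dominated_convergence (μ := (Measure.count : Measure ι))
      (F := fun n i => u n i ^ p.toReal) (f := fun _ => 0) (fun i => g i ^ p.toReal)
      (fun n => measurable_from_top)
      (fun n => Eventually.of_forall fun i => ENNReal.rpow_le_rpow (hug n i) hp.le)
      (by
        rw [lintegral_count, ← seqNorm_rpow_toReal h0 h1]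
        exact ENNReal.rpow_ne_top_of_nonneg hp.le hg)
      (Eventually.of_forall fun i => by
        have := ((ENNReal.continuous_rpow_const (y := p.toReal)).tendsto 0).comp (hu i)
        rwa [ENNReal.zero_rpow_of_pos hp] at this)
    simpa only [lintegral_count, lintegral_zero] using this
  have := ((ENNReal.continuous_rpow_const (y := 1 / p.toReal)).tendsto 0).comp key
  rwa [ENNReal.zero_rpow_of_pos (by positivity)] at this

end SeqNorm

/-! ### Hölder's inequality and the one-variable Young inequality -/

section Convolution

variable {ι : Type*}

theorem tsum_prod_rpow_le {κ : Type*} [Fintype κ] (f : κ → ι → ℝ≥0∞) {e : κ → ℝ}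
    (he : ∑ i, e i = 1) (he0 : ∀ i, 0 ≤ e i) :
    ∑' a, ∏ i, f i a ^ e i ≤ ∏ i, (∑' a, f i a) ^ e i := by
  let _ : MeasurableSpace ι := ⊤
  have := ENNReal.lintegral_prod_norm_pow_le (μ := (Measure.count : Measure ι)) Finset.univ
    (f := f) (fun i _ => measurable_from_top.aemeasurable) he (fun i _ => he0 i)
  simpa only [lintegral_count] using this

theorem tsum_mul_rpow_le (f g : ι → ℝ≥0∞) {a b : ℝ} (ha : 0 ≤ a) (hb : 0 ≤ b) (hab : a + b = 1) :
    ∑' i, f i ^ a * g i ^ b ≤ (∑' i, f i) ^ a * (∑' i, g i) ^ b := by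
  have := tsum_prod_rpow_le ![f, g] (e := ![a, b]) (by simpa using hab)
    (by simp [Fin.forall_fin_two, ha, hb])
  simpa [Fin.prod_univ_two] using this

/-- For finite `r`, raising to the power `r` leaves Hölder with exponents `a r` and `b r`, whose sum
is one. For `r = ∞` both `a` and `b` vanish. -/
theorem seqNorm_mul_rpow_le {r : ℝ≥0∞} (hr : 0 < r) (X Y : ι → ℝ≥0∞) {a b : ℝ} (ha : 0 ≤ a)
    (hb : 0 ≤ b) (hab : a + b = r⁻¹.toReal) :
    seqNorm r (fun j => X j ^ a * Y j ^ b) ≤ (∑' j, X j) ^ a * (∑' j, Y j) ^ b := by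
  by_cases hr' : r = ∞
  · subst hr'
    have h0 : a + b = 0 := by simpa using hab
    have ha' : a = 0 := by linarith
    have hb' : b = 0 := by linarith
    subst ha' hb'
    simp [seqNorm_top]
  · have hR : 0 < r.toReal := ENNReal.toReal_pos hr.ne' hr'
    rw [ENNReal.toReal_inv] at hab
    rw [seqNorm_le_iff hr hr']
    simp only [ENNReal.mul_rpow_of_nonneg _ _ hR.le, ← ENNReal.rpow_mul]
    refine tsum_mul_rpow_le X Y (by positivity) (by positivity) ?_
    rw [← add_mul, hab, inv_mul_cancel₀ hR.ne']

variable {G : Type*} [AddCommGroup G]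

theorem tsum_comp_sub (F : G → ℝ≥0∞) (k : G) : ∑' j, F (j - k) = ∑' j, F j :=
  (Equiv.subRight k).tsum_eq F

theorem tsum_comp_sub_left (F : G → ℝ≥0∞) (j : G) : ∑' k, F (j - k) = ∑' k, F k :=
  (Equiv.subLeft j).tsum_eq F

/-- This is the splitting fed into the four-factor Hölder inequality. Counting exponents for finite
`p`, `b` and `x` occur to the power one and `h` to the power zero. For `p = ∞` the first factor is
trivial and `h` occurs to the power one, so `b ≤ h` is used. -/
theorem mul_le_rpow_mul_rpow {p : ℝ≥0∞} (hp : 0 < p) {b h x : ℝ≥0∞} (hbh : b ≤ h) (hh : h ≠ ∞)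
    {Q S β γ e₂ e₃ e₄ : ℝ} (hβ : Q * β = 1)
    (hγ : S * γ = 1) (e₂0 : 0 ≤ e₂) (e₃0 : 0 ≤ e₃) (hβe : β = p⁻¹.toReal + e₂ + e₄)
    (hγe : γ = e₂ + e₃) :
    b * x ≤ (b ^ p.toReal * h ^ (Q - p.toReal)) ^ p⁻¹.toReal * (h ^ Q * x ^ S) ^ e₂ *
      (x ^ S) ^ e₃ * (h ^ Q) ^ e₄ := by
  by_cases hh0 : h = 0
  · have : b = 0 := le_antisymm (hh0 ▸ hbh) zero_le
    simp [this]
  by_cases hx0 : x = 0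
  · simp [hx0]
  have hxx : x = (x ^ S) ^ e₂ * (x ^ S) ^ e₃ := by
    rw [← ENNReal.rpow_add_of_nonneg _ _ e₂0 e₃0, ← hγe, ← ENNReal.rpow_mul, hγ, ENNReal.rpow_one]
  have hb : b ≤ (b ^ p.toReal * h ^ (Q - p.toReal)) ^ p⁻¹.toReal * (h ^ Q) ^ e₂ * (h ^ Q) ^ e₄ := by
    by_cases hp' : p = ∞
    · subst hp'
      have : Q * e₂ + Q * e₄ = 1 := by
        rw [← hβ, hβe]; simp; ring
      simp only [ENNReal.inv_top, ENNReal.toReal_zero, ENNReal.rpow_zero, one_mul]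
      rwa [← ENNReal.rpow_mul, ← ENNReal.rpow_mul, ← ENNReal.rpow_add _ _ hh0 hh, this,
        ENNReal.rpow_one]
    · have hP : 0 < p.toReal := ENNReal.toReal_pos hp.ne' hp'
      have hα : p.toReal * p⁻¹.toReal = 1 := by
        rw [ENNReal.toReal_inv, mul_inv_cancel₀ hP.ne']
      have : (Q - p.toReal) * p⁻¹.toReal + Q * e₂ + Q * e₄ = 0 := by
        rw [sub_mul, hα, ← hβ, hβe]; ring
      rw [ENNReal.mul_rpow_of_nonneg _ _ ENNReal.toReal_nonneg, ← ENNReal.rpow_mul, hα,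
        ENNReal.rpow_one, ← ENNReal.rpow_mul, ← ENNReal.rpow_mul, ← ENNReal.rpow_mul,
        mul_assoc, mul_assoc, ← ENNReal.rpow_add _ _ hh0 hh, ← ENNReal.rpow_add _ _ hh0 hh,
        ← add_assoc, this, ENNReal.rpow_zero, mul_one]
  calc b * x ≤ ((b ^ p.toReal * h ^ (Q - p.toReal)) ^ p⁻¹.toReal * (h ^ Q) ^ e₂ * (h ^ Q) ^ e₄) *
        ((x ^ S) ^ e₂ * (x ^ S) ^ e₃) := mul_le_mul' hb hxx.le
    _ = _ := by
      rw [ENNReal.mul_rpow_of_nonneg (h ^ Q) (x ^ S) e₂0]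
      ring

/-- The sum of `b^p` is the `p`-th power of the norm, so the exponents add up to `Q`. If the norm is
zero, every term vanishes. -/
theorem tsum_rpow_mul_rpow_le {p : ℝ≥0∞} (hp : 0 < p) (hp' : p ≠ ∞) (b : ι → ℝ≥0∞) {Q : ℝ}
    (hh : seqNorm p b ≠ ∞) :
    ∑' j, b j ^ p.toReal * seqNorm p b ^ (Q - p.toReal) ≤ seqNorm p b ^ Q := by
  have hP : 0 < p.toReal := ENNReal.toReal_pos hp.ne' hp'
  by_cases h0 : seqNorm p b = 0
  · have : ∀ j, b j = 0 := fun j => le_antisymm (h0 ▸ le_seqNorm hp b j) zero_le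
    simp [this, hP]
  · rw [ENNReal.tsum_mul_right, ← seqNorm_rpow_toReal hp hp', ← ENNReal.rpow_add _ _ h0 hh,
      add_sub_cancel]

/-- The one-dimensional estimate for finite `q` and `s`. -/
theorem seqNorm_twisted_conv_le_of_ne_top {p q r s : ℝ≥0∞} (hq : 1 ≤ q) (hqr : q ≤ r)
    (hrp : r ≤ p) (hs : 0 < s) (hq' : q ≠ ∞) (hs' : s ≠ ∞)
    (hpq : r⁻¹.toReal - s⁻¹.toReal = p⁻¹.toReal + (q⁻¹.toReal - 1))
    (B : G → G → ℝ≥0∞) (F : G → ℝ≥0∞)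
    (hH : seqNorm q (fun k => seqNorm p (fun j => B j k)) ≠ ∞) :
    seqNorm r (fun j => ∑' k, B j k * F (j - k)) ≤
      seqNorm q (fun k => seqNorm p (fun j => B j k)) * seqNorm s F := by
  have q0 : 0 < q := one_pos.trans_le hq
  have r0 : 0 < r := q0.trans_le hqr
  have p0 : 0 < p := r0.trans_le hrp
  set h : G → ℝ≥0∞ := fun k => seqNorm p (fun j => B j k) with hh
  have hk : ∀ k, h k ≠ ∞ := fun k => ne_top_of_le_ne_top hH (le_seqNorm q0 h k)
  have hQ : 0 < q.toReal := ENNReal.toReal_pos q0.ne' hq'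
  have hS : 0 < s.toReal := ENNReal.toReal_pos hs.ne' hs'
  have hβ : q.toReal * q⁻¹.toReal = 1 := by
    rw [ENNReal.toReal_inv, mul_inv_cancel₀ hQ.ne']
  have hγ : s.toReal * s⁻¹.toReal = 1 := by
    rw [ENNReal.toReal_inv, mul_inv_cancel₀ hS.ne']
  have hρα : p⁻¹.toReal ≤ r⁻¹.toReal :=
    ENNReal.toReal_mono (ENNReal.inv_ne_top.2 r0.ne') (ENNReal.inv_le_inv.2 hrp)
  have hβρ : r⁻¹.toReal ≤ q⁻¹.toReal :=
    ENNReal.toReal_mono (ENNReal.inv_ne_top.2 q0.ne') (ENNReal.inv_le_inv.2 hqr)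
  have hβ1 : q⁻¹.toReal ≤ 1 := by
    have := ENNReal.toReal_mono ENNReal.one_ne_top (ENNReal.inv_le_one.2 hq)
    simpa using this
  set α := p⁻¹.toReal with hα
  have α0 : 0 ≤ α := ENNReal.toReal_nonneg
  -- The Hölder exponents `α, e₂, e₃, e₄` add up to one. The last three are nonnegative because `r ≤
  -- p`, `1 ≤ q` and `q ≤ r`, respectively.
  obtain ⟨e₂, he₂⟩ : ∃ e, e = r⁻¹.toReal - α := ⟨_, rfl⟩
  obtain ⟨e₃, he₃⟩ : ∃ e, e = 1 - q⁻¹.toReal := ⟨_, rfl⟩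
  obtain ⟨e₄, he₄⟩ : ∃ e, e = q⁻¹.toReal - r⁻¹.toReal := ⟨_, rfl⟩
  have e₂0 : 0 ≤ e₂ := by linarith
  have e₃0 : 0 ≤ e₃ := by linarith
  have e₄0 : 0 ≤ e₄ := by linarith
  have hβe : q⁻¹.toReal = α + e₂ + e₄ := by linarith
  have hγe : s⁻¹.toReal = e₂ + e₃ := by linarith
  have hHQ : seqNorm q h ^ q.toReal = ∑' k, h k ^ q.toReal := seqNorm_rpow_toReal q0 hq' h
  have hFS : seqNorm s F ^ s.toReal = ∑' k, F k ^ s.toReal := seqNorm_rpow_toReal hs hs' F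
  -- For finite `p`, the weight `h^(q-p)` makes the sum of `X` over `j` at most `‖h‖_q^q`; the sum
  -- of `Y` over `j` factors. The other two Hölder factors do not depend on `j` and form `c`.
  set X : G → ℝ≥0∞ := fun j => ∑' k, B j k ^ p.toReal * h k ^ (q.toReal - p.toReal) with hX
  set Y : G → ℝ≥0∞ := fun j => ∑' k, h k ^ q.toReal * F (j - k) ^ s.toReal with hY
  set c : ℝ≥0∞ := (seqNorm s F ^ s.toReal) ^ e₃ * (seqNorm q h ^ q.toReal) ^ e₄ with hc
  have hpoint : ∀ j, ∑' k, B j k * F (j - k) ≤ c * (X j ^ α * Y j ^ e₂) := by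
    intro j
    calc ∑' k, B j k * F (j - k) ≤ ∑' k, (B j k ^ p.toReal * h k ^ (q.toReal - p.toReal)) ^ α *
          (h k ^ q.toReal * F (j - k) ^ s.toReal) ^ e₂ * (F (j - k) ^ s.toReal) ^ e₃ *
            (h k ^ q.toReal) ^ e₄ :=
          ENNReal.tsum_le_tsum fun k => mul_le_rpow_mul_rpow p0
            (le_seqNorm p0 (fun j => B j k) j) (hk k) hβ hγ e₂0 e₃0 hβe hγe
      _ ≤ X j ^ α * Y j ^ e₂ * (∑' k, F (j - k) ^ s.toReal) ^ e₃ *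
            (∑' k, h k ^ q.toReal) ^ e₄ := by
          have := tsum_prod_rpow_le ![fun k => B j k ^ p.toReal * h k ^ (q.toReal - p.toReal),
            fun k => h k ^ q.toReal * F (j - k) ^ s.toReal, fun k => F (j - k) ^ s.toReal,
            fun k => h k ^ q.toReal] (e := ![α, e₂, e₃, e₄])
            (by simp [Fin.sum_univ_four]; linarith)
            (by simp [Fin.forall_fin_succ, α0, e₂0, e₃0, e₄0])
          simpa [Fin.prod_univ_four] using this
      _ = c * (X j ^ α * Y j ^ e₂) := by
          rw [tsum_comp_sub_left (fun k => F k ^ s.toReal), ← hHQ, ← hFS, hc]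
          ring
  have hsumX : (∑' j, X j) ^ α ≤ (seqNorm q h ^ q.toReal) ^ α := by
    by_cases hp' : p = ∞
    · have : α = 0 := by simp [hα, hp']
      simp [this]
    · refine ENNReal.rpow_le_rpow ?_ α0
      rw [hX, ENNReal.tsum_comm, hHQ]
      exact ENNReal.tsum_le_tsum fun k => tsum_rpow_mul_rpow_le p0 hp' _ (hk k)
  have hsumY : ∑' j, Y j = seqNorm q h ^ q.toReal * seqNorm s F ^ s.toReal := by
    rw [hY, ENNReal.tsum_comm, hHQ, ← ENNReal.tsum_mul_right, hFS]
    refine tsum_congr fun k => ?_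
    rw [ENNReal.tsum_mul_left, tsum_comp_sub (fun j => F j ^ s.toReal)]
  calc seqNorm r (fun j => ∑' k, B j k * F (j - k))
      ≤ seqNorm r (fun j => c * (X j ^ α * Y j ^ e₂)) := seqNorm_mono r hpoint
    _ = c * seqNorm r (fun j => X j ^ α * Y j ^ e₂) := seqNorm_const_mul r0 _ _
    _ ≤ c * ((∑' j, X j) ^ α * (∑' j, Y j) ^ e₂) :=
        mul_le_mul_right (seqNorm_mul_rpow_le r0 X Y α0 e₂0 (by linarith)) _
    _ ≤ c * ((seqNorm q h ^ q.toReal) ^ α *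
          (seqNorm q h ^ q.toReal * seqNorm s F ^ s.toReal) ^ e₂) := by
        rw [hsumY]
        gcongr
    _ = ((seqNorm q h ^ q.toReal) ^ α * (seqNorm q h ^ q.toReal) ^ e₂ *
          (seqNorm q h ^ q.toReal) ^ e₄) *
          ((seqNorm s F ^ s.toReal) ^ e₂ * (seqNorm s F ^ s.toReal) ^ e₃) := by
        rw [ENNReal.mul_rpow_of_nonneg _ _ e₂0, hc]
        ring
    _ = seqNorm q h * seqNorm s F := by
        rw [← ENNReal.rpow_add_of_nonneg _ _ α0 e₂0,
          ← ENNReal.rpow_add_of_nonneg _ _ (add_nonneg α0 e₂0) e₄0,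
          ← ENNReal.rpow_add_of_nonneg _ _ e₂0 e₃0, ← hβe, ← hγe, ← ENNReal.rpow_mul,
          ← ENNReal.rpow_mul, hβ, hγ, ENNReal.rpow_one, ENNReal.rpow_one]

/-- A Young type inequality for `j ↦ ∑ₖ B(j, k) F(j - k)`, with `B` measured in `ℓ^p` with respect
to `j` and then in `ℓ^q` with respect to `k`. -/
theorem seqNorm_twisted_conv_le [Countable G] {p q r s : ℝ≥0∞} (hq : 1 ≤ q) (hqr : q ≤ r)
    (hrp : r ≤ p) (hs : 0 < s)
    (hpq : r⁻¹.toReal - s⁻¹.toReal = p⁻¹.toReal + (q⁻¹.toReal - 1))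
    (B : G → G → ℝ≥0∞) (F : G → ℝ≥0∞) :
    seqNorm r (fun j => ∑' k, B j k * F (j - k)) ≤
      seqNorm q (fun k => seqNorm p (fun j => B j k)) * seqNorm s F := by
  have q0 : 0 < q := one_pos.trans_le hq
  have r0 : 0 < r := q0.trans_le hqr
  have p0 : 0 < p := r0.trans_le hrp
  set H := seqNorm q (fun k => seqNorm p (fun j => B j k)) with hH
  have hBH : ∀ j k, B j k ≤ H := fun j k =>
    (le_seqNorm p0 (fun j => B j k) j).trans
      (le_seqNorm q0 (fun k => seqNorm p (fun j => B j k)) k)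
  -- The degenerate cases go first, since `0 * ∞ = 0` would spoil the trivial bounds.
  by_cases hH0 : H = 0
  · have : ∀ j k, B j k = 0 := fun j k => le_antisymm (hH0 ▸ hBH j k) zero_le
    simp [this, seqNorm_zero]
  by_cases hF0 : seqNorm s F = 0
  · have : ∀ k, F k = 0 := fun k => le_antisymm (hF0 ▸ le_seqNorm hs F k) zero_le
    simp [this, seqNorm_zero]
  by_cases hHt : H = ∞
  · rw [hHt, ENNReal.top_mul hF0]
    exact le_top
  by_cases hFt : seqNorm s F = ∞
  · rw [hFt, ENNReal.mul_top hH0]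
    exact le_top
  have hpr : p⁻¹.toReal ≤ r⁻¹.toReal :=
    ENNReal.toReal_mono (ENNReal.inv_ne_top.2 r0.ne') (ENNReal.inv_le_inv.2 hrp)
  have hβ1 : q⁻¹.toReal ≤ 1 := by
    have := ENNReal.toReal_mono ENNReal.one_ne_top (ENNReal.inv_le_one.2 hq)
    simpa using this
  have eq_of_inv : ∀ {x y : ℝ≥0∞}, 0 < x → 0 < y → x⁻¹.toReal = y⁻¹.toReal → x = y := by
    intro x y hx hy hxy
    rwa [ENNReal.toReal_eq_toReal_iff' (ENNReal.inv_ne_top.2 hx.ne')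
      (ENNReal.inv_ne_top.2 hy.ne'), inv_inj] at hxy
  -- Here `r = p = ∞` and `s = 1`, and `B` is bounded by its supremum.
  by_cases hqt : q = ∞
  · obtain rfl : r = ∞ := top_le_iff.1 (hqt ▸ hqr)
    obtain rfl : p = ∞ := top_le_iff.1 hrp
    obtain rfl : s = 1 := eq_of_inv hs one_pos (by simp [hqt] at hpq ⊢; linarith)
    rw [seqNorm_top, seqNorm_one]
    refine iSup_le fun j => ?_
    rw [← tsum_comp_sub_left F j, ← ENNReal.tsum_mul_left]
    exact ENNReal.tsum_le_tsum fun k => mul_le_mul_left (hBH j k) _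
  -- Since `1/r = 1/p + 1/q - 1`, while `1/p ≤ 1/r` and `1/q ≤ 1`, this forces `q = 1` and `r = p`,
  -- where Minkowski's inequality suffices.
  by_cases hst : s = ∞
  · subst hst
    simp only [ENNReal.inv_top, ENNReal.toReal_zero] at hpq
    obtain rfl : q = 1 := eq_of_inv q0 one_pos (by rw [inv_one, ENNReal.toReal_one]; linarith)
    obtain rfl : r = p := eq_of_inv r0 p0 (by rw [inv_one, ENNReal.toReal_one] at hpq; linarith)
    calc seqNorm r (fun j => ∑' k, B j k * F (j - k))
        ≤ ∑' k, seqNorm r (fun j => B j k * F (j - k)) := seqNorm_tsum_le hqr _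
      _ ≤ ∑' k, seqNorm ∞ F * seqNorm r (fun j => B j k) := by
          refine ENNReal.tsum_le_tsum fun k => ?_
          rw [← seqNorm_const_mul r0]
          refine seqNorm_mono r fun j => ?_
          rw [mul_comm]
          exact mul_le_mul_left (le_seqNorm hs F _) _
      _ = H * seqNorm ∞ F := by rw [ENNReal.tsum_mul_left, hH, seqNorm_one, mul_comm]
  exact seqNorm_twisted_conv_le_of_ne_top hq hqr hrp hs hqt hst hpq B F hHt

end Convolution

/-! ### Mixed quasi-norms: powers, dominated convergence, finite support -/

section MixedNorm

theorem le_mixedNorm : ∀ {d : ℕ} {p : Fin d → ℝ≥0∞}, (∀ m, 0 < p m) →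
    ∀ (g : (Fin d → ℤ) → ℝ≥0∞) (n : Fin d → ℤ), g n ≤ mixedNorm p g
  | 0, _, _, g, n => by
      rw [Subsingleton.elim n Fin.elim0]
      exact le_rfl
  | d + 1, p, hp, g, n => by
      refine le_trans ?_ (le_mixedNorm (p := Fin.tail p) (fun m => hp m.succ) _ (Fin.tail n))
      have := le_seqNorm (hp 0) (fun t : ℤ => g (Fin.cons t (Fin.tail n))) (n 0)
      rwa [Fin.cons_self_tail] at this

theorem mixedNorm_rpow : ∀ {d : ℕ} {p : Fin d → ℝ≥0∞}, (∀ m, 0 < p m) → ∀ {r : ℝ≥0}, 0 < r →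
    ∀ g : (Fin d → ℤ) → ℝ≥0∞,
      mixedNorm p (fun n => g n ^ (r : ℝ)) = mixedNorm (fun m => p m * r) g ^ (r : ℝ)
  | 0, _, _, _, _, _ => rfl
  | d + 1, p, hp, r, hr, g => by
      change mixedNorm (Fin.tail p) _ = mixedNorm (Fin.tail fun m => p m * r) _ ^ (r : ℝ)
      simp only [seqNorm_rpow (hp 0) hr]
      exact mixedNorm_rpow (p := Fin.tail p) (fun m => hp m.succ) hr _

/-- Dominated convergence is used one variable at a time. The inner norm of `g` is finite at every
point because the mixed norm bounds it, and it serves as the majorant for the remaining variables.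
-/
theorem tendsto_mixedNorm_zero : ∀ {d : ℕ} {p : Fin d → ℝ≥0∞}, (∀ m, 0 < p m) →
    (∀ m, p m ≠ ∞) → ∀ {u : ℕ → (Fin d → ℤ) → ℝ≥0∞} {g : (Fin d → ℤ) → ℝ≥0∞},
    (∀ n i, u n i ≤ g i) → mixedNorm p g ≠ ∞ → (∀ i, Tendsto (fun n => u n i) atTop (𝓝 0)) →
    Tendsto (fun n => mixedNorm p (u n)) atTop (𝓝 0)
  | 0, _, _, _, _, _, _, _, hu => hu _
  | d + 1, p, hp, hp', u, g, hug, hg, hu => by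
      refine tendsto_mixedNorm_zero (p := Fin.tail p) (fun m => hp m.succ) (fun m => hp' m.succ)
        (fun n y => seqNorm_mono (p 0) fun t => hug n (Fin.cons t y)) hg fun y => ?_
      refine tendsto_seqNorm_zero (hp 0) (hp' 0) (fun n t => hug n (Fin.cons t y)) ?_
        fun t => hu _
      exact ne_top_of_le_ne_top hg (le_mixedNorm (p := Fin.tail p) (fun m => hp m.succ)
        (fun y => seqNorm (p 0) fun t => g (Fin.cons t y)) y)

theorem seqNorm_ne_top_of_finite_support {ι : Type*} {p : ℝ≥0∞} (h0 : 0 < p) {g : ι → ℝ≥0∞}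
    (hg : ∀ i, g i ≠ ∞) (hs : g.support.Finite) : seqNorm p g ≠ ∞ := by
  by_cases h1 : p = ∞
  · subst h1
    rw [seqNorm_top]
    refine ne_top_of_le_ne_top (ENNReal.sum_ne_top.2 fun i (_ : i ∈ hs.toFinset) => hg i)
      (iSup_le fun i => ?_)
    by_cases hi : g i = 0
    · simp [hi]
    · exact Finset.single_le_sum (f := g) (fun _ _ => zero_le) (by simpa using hi)
  · have hp : 0 < p.toReal := ENNReal.toReal_pos h0.ne' h1
    rw [seqNorm_eq_tsum h0 h1]
    refine ENNReal.rpow_ne_top_of_nonneg (by positivity) ?_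
    rw [tsum_eq_sum (s := hs.toFinset)]
    · exact ENNReal.sum_ne_top.2 fun i _ => ENNReal.rpow_ne_top_of_nonneg hp.le (hg i)
    · intro i hi
      have : g i = 0 := by simpa using hi
      simp [this, hp]

theorem mixedNorm_ne_top_of_finite_support : ∀ {d : ℕ} {p : Fin d → ℝ≥0∞}, (∀ m, 0 < p m) →
    ∀ {g : (Fin d → ℤ) → ℝ≥0∞}, (∀ i, g i ≠ ∞) → g.support.Finite → mixedNorm p g ≠ ∞
  | 0, _, _, _, hg, _ => hg _
  | d + 1, p, hp, g, hg, hs => by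
      refine mixedNorm_ne_top_of_finite_support (p := Fin.tail p) (fun m => hp m.succ)
        (fun y => seqNorm_ne_top_of_finite_support (hp 0) (fun t => hg _) ?_)
        ((hs.image Fin.tail).subset fun y hy => ?_)
      · refine (hs.image fun n => n 0).subset fun t ht => ⟨Fin.cons t y, ht, by simp⟩
      · by_contra hcon
        refine hy ?_
        have : ∀ t : ℤ, g (Fin.cons t y) = 0 := fun t => by
          by_contra ht
          exact hcon ⟨Fin.cons t y, ht, by simp⟩
        simp only [this, seqNorm_zero]

end MixedNorm

/-! ### The Young inequality in mixed norms -/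

section MixedConvolution

theorem tsum_cons {d : ℕ} (f : (Fin (d + 1) → ℤ) → ℝ≥0∞) :
    ∑' k, f k = ∑' (k' : Fin d → ℤ) (k : ℤ), f (Fin.cons k k') := by
  simpa only [seqNorm_one] using seqNorm_cons one_pos f

theorem cons_sub_cons {d : ℕ} (j k : ℤ) (j' k' : Fin d → ℤ) :
    (Fin.cons j j' - Fin.cons k k' : Fin (d + 1) → ℤ) = Fin.cons (j - k) (j' - k') := by
  funext i
  refine Fin.cases ?_ (fun i => ?_) i <;> simp

/-- There is a single index. This case stands apart because componentwise conditions do not yield `q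
≤ p` when `d = 0`. -/
theorem mixedNorm_twisted_conv_le_zero {p q : ℝ≥0∞} (q0 : 0 < q) (p0 : 0 < p)
    (r s : Fin 0 → ℝ≥0∞) (B : (Fin 0 → ℤ) → (Fin 0 → ℤ) → ℝ≥0∞) (F : (Fin 0 → ℤ) → ℝ≥0∞) :
    mixedNorm r (fun j => ∑' k, B j k * F (j - k)) ≤
      seqNorm q (fun k => seqNorm p (fun j => B j k)) * mixedNorm s F := by
  change ∑' k, B Fin.elim0 k * F (Fin.elim0 - k) ≤ _ * F Fin.elim0
  rw [tsum_eq_single Fin.elim0 fun b hb => absurd (Subsingleton.elim _ _) hb,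
    Subsingleton.elim (Fin.elim0 - Fin.elim0) (Fin.elim0 : Fin 0 → ℤ)]
  refine mul_le_mul_left ?_ _
  exact (le_seqNorm p0 (fun j => B j Fin.elim0) _).trans
    (le_seqNorm q0 (fun k => seqNorm p (fun j => B j k)) Fin.elim0)

theorem mixedNorm_twisted_conv_le_of_one_le {p q : ℝ≥0∞} (hq : 1 ≤ q) :
    ∀ {d : ℕ} {r s : Fin d → ℝ≥0∞}, (∀ m, q ≤ r m) → (∀ m, r m ≤ p) → q ≤ p → (∀ m, 0 < s m) →
    (∀ m, (r m)⁻¹.toReal - (s m)⁻¹.toReal = p⁻¹.toReal + (q⁻¹.toReal - 1)) →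
    ∀ (B : (Fin d → ℤ) → (Fin d → ℤ) → ℝ≥0∞) (F : (Fin d → ℤ) → ℝ≥0∞),
    mixedNorm r (fun j => ∑' k, B j k * F (j - k)) ≤
      seqNorm q (fun k => seqNorm p (fun j => B j k)) * mixedNorm s F
  | 0, r, s, _, _, hqp, _, _, B, F => by
      have q0 : 0 < q := one_pos.trans_le hq
      have p0 : 0 < p := q0.trans_le hqp
      exact mixedNorm_twisted_conv_le_zero q0 (q0.trans_le hqp) r s B F
  | d + 1, r, s, hqr, hrp, hqp, hs, h, B, F => by
      have q0 : 0 < q := one_pos.trans_le hq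
      have p0 : 0 < p := q0.trans_le hqp
      -- The induction hypothesis is applied to the norms of `B` and `F` in the first variable,
      -- which are what the one-variable estimate produces.
      let B' : (Fin d → ℤ) → (Fin d → ℤ) → ℝ≥0∞ := fun j' k' =>
        seqNorm q fun k : ℤ => seqNorm p fun j : ℤ => B (Fin.cons j j') (Fin.cons k k')
      let F' : (Fin d → ℤ) → ℝ≥0∞ := fun y => seqNorm (s 0) fun t : ℤ => F (Fin.cons t y)
      have ih := mixedNorm_twisted_conv_le_of_one_le hq (r := Fin.tail r) (s := Fin.tail s)
        (fun m => hqr m.succ) (fun m => hrp m.succ) hqp (fun m => hs m.succ) (fun m => h m.succ)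
        B' F'
      refine le_trans (mixedNorm_mono (Fin.tail r) fun j' => ?_)
        (ih.trans (mul_le_mul_left ?_ _))
      · simp only [tsum_cons, cons_sub_cons]
        -- Since `r 0 ≥ q ≥ 1`, Minkowski's inequality pulls the sum over `k'` out of the first
        -- norm.
        refine (seqNorm_tsum_le (hq.trans (hqr 0)) _).trans (ENNReal.tsum_le_tsum fun k' => ?_)
        exact seqNorm_twisted_conv_le hq (hqr 0) (hrp 0) (hs 0) (h 0)
          (fun j k => B (Fin.cons j j') (Fin.cons k k')) fun t => F (Fin.cons t (j' - k'))
      · rw [seqNorm_cons q0]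
        refine seqNorm_mono q fun k' => ?_
        -- `B'` yields the order `j, k, j', k'` of norms, from the inside out. Moving `ℓ^p` in `j'`
        -- inside `ℓ^q` in `k` can only increase the value, as `q ≤ p`.
        simp only [seqNorm_cons p0]
        exact seqNorm_seqNorm_le q0 hqp _

theorem mixedNorm_twisted_conv_le {p q : ℝ≥0∞} (q0 : 0 < q) (p0 : 0 < p) {d : ℕ}
    {r s : Fin d → ℝ≥0∞} (hqr : ∀ m, q ≤ r m) (hrp : ∀ m, r m ≤ p) (hs : ∀ m, 0 < s m)
    (h : ∀ m, (r m)⁻¹.toReal - (s m)⁻¹.toReal = p⁻¹.toReal + min 0 (q⁻¹.toReal - 1))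
    (B : (Fin d → ℤ) → (Fin d → ℤ) → ℝ≥0∞) (F : (Fin d → ℤ) → ℝ≥0∞) :
    mixedNorm r (fun j => ∑' k, B j k * F (j - k)) ≤
      seqNorm q (fun k => seqNorm p (fun j => B j k)) * mixedNorm s F := by
  rcases Nat.eq_zero_or_pos d with rfl | hd
  · exact mixedNorm_twisted_conv_le_zero q0 p0 r s B F
  have hqp : q ≤ p := (hqr ⟨0, hd⟩).trans (hrp ⟨0, hd⟩)
  rcases le_total 1 q with hq | hq
  · have hq1 : q⁻¹.toReal ≤ 1 := by
      simpa using ENNReal.toReal_mono ENNReal.one_ne_top (ENNReal.inv_le_one.2 hq)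
    refine mixedNorm_twisted_conv_le_of_one_le hq hqr hrp hqp hs (fun m => ?_) B F
    rw [h m, min_eq_right (by linarith)]
  · have hqt : q ≠ ∞ := ne_top_of_le_ne_top ENNReal.one_ne_top hq
    have hq1 : 1 ≤ q⁻¹.toReal := by
      simpa using ENNReal.toReal_mono (ENNReal.inv_ne_top.2 q0.ne') (ENNReal.one_le_inv.2 hq)
    lift q to ℝ≥0 using hqt
    have hq0 : (0 : ℝ≥0) < q := by exact_mod_cast q0
    have hqr0 : (0 : ℝ) < q := hq0
    have r0 : ∀ m, 0 < r m := fun m => q0.trans_le (hqr m)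
    have hdiv : ∀ x : ℝ≥0∞, x / q * q = x := fun x =>
      ENNReal.div_mul_cancel q0.ne' ENNReal.coe_ne_top
    have hdiv0 : ∀ {x : ℝ≥0∞}, 0 < x → 0 < x / q := fun hx =>
      ENNReal.div_pos hx.ne' ENNReal.coe_ne_top
    have hmixed : ∀ {t : Fin d → ℝ≥0∞}, (∀ m, 0 < t m) → ∀ g : (Fin d → ℤ) → ℝ≥0∞,
        mixedNorm t g ^ (q : ℝ) = mixedNorm (fun m => t m / q) (fun n => g n ^ (q : ℝ)) := by
      intro t ht g
      rw [mixedNorm_rpow (fun m => hdiv0 (ht m)) hq0]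
      simp only [hdiv]
    have hinv : ∀ x : ℝ≥0∞, (x / q)⁻¹.toReal = q * x⁻¹.toReal := fun x => by
      rw [ENNReal.inv_div (Or.inl ENNReal.coe_ne_top) (Or.inl q0.ne'), div_eq_mul_inv,
        ENNReal.toReal_mul, ENNReal.coe_toReal]
    rw [← ENNReal.rpow_le_rpow_iff hqr0, ENNReal.mul_rpow_of_nonneg _ _ hqr0.le, hmixed r0,
      hmixed hs]
    -- For `q ≤ 1` the minimum is zero, so the exponent relation multiplied by `q` is the relation
    -- for `r/q, s/q, p/q` and `q = 1`.
    have hle := mixedNorm_twisted_conv_le_of_one_le (p := p / q) (q := 1) le_rfl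
      (r := fun m => r m / q) (s := fun m => s m / q)
      (fun m => by
        rw [ENNReal.le_div_iff_mul_le (Or.inl q0.ne') (Or.inl ENNReal.coe_ne_top), one_mul]
        exact hqr m)
      (fun m => ENNReal.div_le_div_right (hrp m) _)
      (by
        rw [ENNReal.le_div_iff_mul_le (Or.inl q0.ne') (Or.inl ENNReal.coe_ne_top), one_mul]
        exact hqp)
      (fun m => hdiv0 (hs m))
      (fun m => by
        have := h m
        rw [min_eq_left (by linarith), add_zero] at this
        rw [hinv, hinv, hinv, ← mul_sub, this]
        simp)
      (fun j k => B j k ^ (q : ℝ)) (fun k => F k ^ (q : ℝ))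
    refine le_trans (mixedNorm_mono _ fun j => ?_) (hle.trans (le_of_eq ?_))
    · refine (ENNReal.rpow_le_rpow (tsum_le_seqNorm q0 hq _) hqr0.le).trans_eq ?_
      have := seqNorm_rpow_toReal q0 ENNReal.coe_ne_top (fun k => B j k * F (j - k))
      simp only [ENNReal.coe_toReal] at this
      simp only [this, ENNReal.mul_rpow_of_nonneg _ _ hqr0.le]
    · congr 1
      have := seqNorm_rpow_toReal q0 ENNReal.coe_ne_top (fun k => seqNorm p fun j => B j k)
      rw [ENNReal.coe_toReal] at this
      rw [seqNorm_one, this]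
      refine tsum_congr fun k => ?_
      rw [seqNorm_rpow (hdiv0 p0) hq0, hdiv]

end MixedConvolution

/-! ### Transfer from the lattice to `ℤ^d` -/

section Lattice

variable {d : ℕ} {σ : Equiv.Perm (Fin d)} {θ : Fin d → ℝ}

/-- The parametrization `n ↦ T_θ (n ∘ σ⁻¹)` of the lattice used in `latticeNorm`. -/
noncomputable def latticeEquiv (σ : Equiv.Perm (Fin d)) (hθ : ∀ i, θ i ≠ 0) :
    (Fin d → ℤ) ≃ lattice θ :=
  Equiv.ofBijective (fun n => latticePoint θ (n ∘ σ.symm)) <| by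
    constructor
    · intro m n h
      funext i
      have := congrFun (congrArg Subtype.val h) (σ i)
      simpa [latticePoint, hθ] using this
    · rintro ⟨_, n, rfl⟩
      exact ⟨n ∘ σ, by simp [latticePoint]⟩

theorem latticeEquiv_apply (hθ : ∀ i, θ i ≠ 0) (n : Fin d → ℤ) :
    latticeEquiv σ hθ n = latticePoint θ (n ∘ σ.symm) := rfl

theorem latticeEquiv_sub (hθ : ∀ i, θ i ≠ 0) (m n : Fin d → ℤ) :
    latticeEquiv σ hθ (m - n) = latticeEquiv σ hθ m - latticeEquiv σ hθ n := by
  refine Subtype.ext (funext fun i => ?_)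
  simp [latticeEquiv_apply, latticePoint, mul_sub]

theorem countable_lattice (hθ : ∀ i, θ i ≠ 0) : Countable (lattice θ) :=
  (latticeEquiv 1 hθ).symm.injective.countable

theorem latticeNorm_eq (hθ : ∀ i, θ i ≠ 0) (p : Fin d → ℝ≥0∞) (ω : lattice θ → ℝ)
    (f : lattice θ → ℂ) :
    latticeNorm σ θ p ω f = mixedNorm p fun n =>
      ‖f (latticeEquiv σ hθ n) * (ω (latticeEquiv σ hθ n) : ℂ)‖ₑ := rfl

theorem le_latticeNorm (hθ : ∀ i, θ i ≠ 0) {p : Fin d → ℝ≥0∞} (hp : ∀ m, 0 < p m)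
    (ω : lattice θ → ℝ) (f : lattice θ → ℂ) (j : lattice θ) :
    ‖f j * (ω j : ℂ)‖ₑ ≤ latticeNorm σ θ p ω f := by
  rw [latticeNorm_eq hθ]
  have := le_mixedNorm hp (fun n => ‖f (latticeEquiv σ hθ n) * (ω (latticeEquiv σ hθ n) : ℂ)‖ₑ)
    ((latticeEquiv σ hθ).symm j)
  simpa only [Equiv.apply_symm_apply] using this

theorem mem_mixedSubmodule_of_finite_support (hθ : ∀ i, θ i ≠ 0) {p : Fin d → ℝ≥0∞}
    (hp : ∀ m, 0 < p m) (ω : lattice θ → ℝ) {f : lattice θ → ℂ} (hf : f.support.Finite) :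
    f ∈ mixedSubmodule σ θ p ω := by
  refine (mixedNorm_ne_top_of_finite_support hp (fun n => enorm_ne_top) ?_).lt_top
  refine (hf.preimage (latticeEquiv σ hθ).injective.injOn).subset fun n hn => ?_
  simp only [Function.mem_support, Set.mem_preimage] at hn ⊢
  intro h0
  rw [latticeEquiv_apply] at h0
  simp [h0] at hn

/-- The parametrization respects differences, and unmixed norms are invariant under bijections of
the index set, so `σ` plays no role in the value. -/
theorem uNorm_eq (σ : Equiv.Perm (Fin d)) (hθ : ∀ i, θ i ≠ 0) {p q : ℝ≥0∞} (hp : 0 < p)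
    (hq : 0 < q) (ω : lattice θ → lattice θ → ℝ) (A : Matrix (lattice θ) (lattice θ) ℂ) :
    uNorm θ p q ω A = seqNorm q fun m : Fin d → ℤ => seqNorm p fun n : Fin d → ℤ =>
      ‖A (latticeEquiv σ hθ n) (latticeEquiv σ hθ (n - m)) *
        (ω (latticeEquiv σ hθ n) (latticeEquiv σ hθ (n - m)) : ℂ)‖ₑ := by
  unfold uNorm
  rw [← seqNorm_equiv hq (latticeEquiv σ hθ)]
  simp only [latticeEquiv_sub]
  congr 1
  funext m
  exact (seqNorm_equiv hp (latticeEquiv σ hθ) _).symm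

theorem enorm_weight_mul_le {a x : ℂ} {w₀ w₁ w₂ : ℝ} (h₁ : 0 < w₁) (h₂ : 0 < w₂) (h₀ : 0 < w₀)
    (h : w₂ / w₁ ≤ w₀) : ‖a * x‖ₑ * ‖(w₂ : ℂ)‖ₑ ≤ ‖a * (w₀ : ℂ)‖ₑ * ‖x * (w₁ : ℂ)‖ₑ := by
  rw [← enorm_mul, ← enorm_mul, ← ofReal_norm, ← ofReal_norm]
  refine ENNReal.ofReal_le_ofReal ?_
  simp only [norm_mul, Complex.norm_real, Real.norm_of_nonneg h₁.le, Real.norm_of_nonneg h₂.le,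
    Real.norm_of_nonneg h₀.le]
  rw [div_le_iff₀ h₁] at h
  calc ‖a‖ * ‖x‖ * w₂ ≤ ‖a‖ * ‖x‖ * (w₀ * w₁) := by gcongr
    _ = ‖a‖ * w₀ * (‖x‖ * w₁) := by ring

variable {ω₁ ω₂ : lattice θ → ℝ} {ω₀ : lattice θ → lattice θ → ℝ} {p₁ p₂ : Fin d → ℝ≥0∞}
  {p q : ℝ≥0∞}

/-- The norm estimate for the matrix acting by absolute values. -/
theorem mixedNorm_tsum_enorm_le (hθ : ∀ i, θ i ≠ 0) (hω₁ : ∀ j, 0 < ω₁ j) (hω₂ : ∀ j, 0 < ω₂ j)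
    (hω₀ : ∀ j k, 0 < ω₀ j k) (hω : ∀ j k, ω₂ j / ω₁ k ≤ ω₀ j k) (hp₁ : ∀ m, 0 < p₁ m)
    (hp : 0 < p) (hq : 0 < q)
    (hpq : ∀ m, (p₂ m)⁻¹.toReal - (p₁ m)⁻¹.toReal = p⁻¹.toReal + min 0 (q⁻¹.toReal - 1))
    (hqp₂ : ∀ m, q ≤ p₂ m) (hp₂p : ∀ m, p₂ m ≤ p) (A : Matrix (lattice θ) (lattice θ) ℂ)
    (f : lattice θ → ℂ) :
    mixedNorm p₂ (fun n => (∑' k, ‖A (latticeEquiv σ hθ n) k * f k‖ₑ) *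
        ‖(ω₂ (latticeEquiv σ hθ n) : ℂ)‖ₑ) ≤
      uNorm θ p q ω₀ A * latticeNorm σ θ p₁ ω₁ f := by
  rw [uNorm_eq σ hθ hp hq, latticeNorm_eq hθ]
  refine (mixedNorm_mono p₂ fun n => ?_).trans
    (mixedNorm_twisted_conv_le hq hp hqp₂ hp₂p hp₁ hpq _ _)
  -- The substitution of `n - m` for the summation index gives the twisted convolution.
  rw [← (latticeEquiv σ hθ).tsum_eq, ← tsum_comp_sub_left (G := Fin d → ℤ) _ n,
    ← ENNReal.tsum_mul_right]
  exact ENNReal.tsum_le_tsum fun m => enorm_weight_mul_le (hω₁ _) (hω₂ _) (hω₀ _ _) (hω _ _)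

end Lattice

/-! ### Continuity and truncation in the quasi-norm topology -/

namespace MixedSeq

variable {d : ℕ} {σ : Equiv.Perm (Fin d)} {θ : Fin d → ℝ} {p p₁ p₂ : Fin d → ℝ≥0∞}
  {ω ω₁ ω₂ : lattice θ → ℝ}

theorem ext {f g : MixedSeq σ θ p ω} (h : ∀ j, f j = g j) : f = g := Subtype.ext (funext h)

theorem continuous_of_qnorm_le {C : ℝ≥0∞} (hC : C ≠ ∞)
    (T : MixedSeq σ θ p₁ ω₁ →ₗ[ℂ] MixedSeq σ θ p₂ ω₂) (hT : ∀ f, qnorm (T f) ≤ C * qnorm f) :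
    Continuous T := by
  refine ⟨fun U hU f hf => ?_⟩
  obtain ⟨ε, hε, h⟩ := hU (T f) hf
  -- `C + 1` replaces `C` so that the divisor below is nonzero.
  have hC1 : C + 1 ≠ ∞ := ENNReal.add_ne_top.2 ⟨hC, ENNReal.one_ne_top⟩
  refine ⟨ε / (C + 1), ENNReal.div_pos hε.ne' hC1, fun g hg => h (T g) ?_⟩
  rw [← map_sub]
  calc qnorm (T (g - f)) ≤ C * qnorm (g - f) := hT _
    _ ≤ (C + 1) * qnorm (g - f) := mul_le_mul_left le_self_add _
    _ < ε := ENNReal.mul_lt_of_lt_div' hg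

/-- The quasi-norm dominates `|f(j)| ω(j)` at each point. Quasi-norm limits can therefore be
compared entry by entry. -/
theorem continuous_eval (hθ : ∀ i, θ i ≠ 0) (hp : ∀ m, 0 < p m) (hω : ∀ j, 0 < ω j)
    (j : lattice θ) : Continuous fun f : MixedSeq σ θ p ω => f j := by
  refine ⟨fun U hU f hf => ?_⟩
  obtain ⟨δ, hδ, h⟩ := Metric.isOpen_iff.1 hU (f j) hf
  refine ⟨ENNReal.ofReal (δ * ω j), ENNReal.ofReal_pos.2 (mul_pos hδ (hω j)), fun g hg => h ?_⟩
  have hlt : ‖(g j - f j) * (ω j : ℂ)‖ₑ < ENNReal.ofReal (δ * ω j) :=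
    (le_latticeNorm hθ hp ω (g - f).toFun j).trans_lt hg
  rw [← ofReal_norm, ENNReal.ofReal_lt_ofReal_iff (mul_pos hδ (hω j)), norm_mul,
    Complex.norm_real, Real.norm_of_nonneg (hω j).le] at hlt
  rw [Metric.mem_ball, dist_eq_norm]
  exact lt_of_mul_lt_mul_right hlt (hω j).le

theorem tendsto_of_qnorm {u : ℕ → MixedSeq σ θ p ω} {f : MixedSeq σ θ p ω}
    (h : Tendsto (fun n => qnorm (u n - f)) atTop (𝓝 0)) : Tendsto u atTop (𝓝 f) := by
  refine tendsto_nhds.2 fun U hU hf => ?_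
  obtain ⟨ε, hε, hεU⟩ := hU f hf
  filter_upwards [h.eventually (gt_mem_nhds hε)] with n hn using hεU _ hn

/-- The restriction of a sequence to an increasing family of finite sets. -/
theorem exists_truncation (hθ : ∀ i, θ i ≠ 0) (hp : ∀ m, 0 < p m) (f : MixedSeq σ θ p ω) :
    ∃ u : ℕ → MixedSeq σ θ p ω, (∀ n, (u n).toFun.support.Finite) ∧
      (∀ n k, u n k = f k ∨ u n k = 0) ∧ ∀ k, ∀ᶠ n in atTop, u n k = f k := by
  classical
  have := countable_lattice hθ
  obtain ⟨e, he⟩ := exists_injective_nat (lattice θ)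
  have hfin : ∀ n, (fun k => if e k < n then f k else 0 : lattice θ → ℂ).support.Finite := by
    refine fun n => ((Set.finite_Iio n).preimage he.injOn).subset fun k hk => ?_
    by_contra hcon
    exact hk (if_neg hcon)
  refine ⟨fun n => ⟨_, mem_mixedSubmodule_of_finite_support hθ hp ω (hfin n)⟩, hfin, fun n k => ?_,
    fun k => ?_⟩
  · change (if e k < n then f k else 0) = _ ∨ (if e k < n then f k else 0) = _
    split_ifs <;> simp
  · filter_upwards [eventually_gt_atTop (e k)] with n hn using if_pos hn

/-- The error is at most `|f|` and eventually zero at each point, so dominated convergence in the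
mixed norm applies. -/
theorem tendsto_truncation (hp : ∀ m, 0 < p m) (hp' : ∀ m, p m ≠ ∞) {f : MixedSeq σ θ p ω}
    {u : ℕ → MixedSeq σ θ p ω} (hu : ∀ n k, u n k = f k ∨ u n k = 0)
    (hu' : ∀ k, ∀ᶠ n in atTop, u n k = f k) : Tendsto u atTop (𝓝 f) := by
  refine tendsto_of_qnorm (tendsto_mixedNorm_zero hp hp'
    (u := fun n i => ‖(u n (latticePoint θ (i ∘ σ.symm)) - f (latticePoint θ (i ∘ σ.symm))) *
      (ω (latticePoint θ (i ∘ σ.symm)) : ℂ)‖ₑ)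
    (g := fun i => ‖f (latticePoint θ (i ∘ σ.symm)) * (ω (latticePoint θ (i ∘ σ.symm)) : ℂ)‖ₑ)
    (fun n i => ?_) (ne_of_lt f.2) fun i => ?_)
  · rcases hu n (latticePoint θ (i ∘ σ.symm)) with h | h <;> simp [h]
  · refine tendsto_const_nhds.congr' ?_
    filter_upwards [hu' (latticePoint θ (i ∘ σ.symm))] with n hn
    simp [hn]

theorem eq_of_finite_support {A : Matrix (lattice θ) (lattice θ) ℂ}
    {S T : MixedSeq σ θ p₁ ω₁ → MixedSeq σ θ p₂ ω₂} (hS : Extends A S) (hT : Extends A T)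
    {f : MixedSeq σ θ p₁ ω₁} (hf : f.toFun.support.Finite) (j : lattice θ) : S f j = T f j := by
  obtain ⟨_, h⟩ := hS f.toFun hf
  obtain ⟨_, h'⟩ := hT f.toFun hf
  exact (h j).trans (h' j).symm

end MixedSeq

/-! ### The main theorem -/

theorem theorem2p3 {d : ℕ} (σ : Equiv.Perm (Fin d)) (θ : Fin d → ℝ) (hθ : ∀ i, θ i ≠ 0)
    (ω₁ ω₂ : lattice θ → ℝ) (hω₁ : ∀ j, 0 < ω₁ j) (hω₂ : ∀ j, 0 < ω₂ j)
    (ω₀ : lattice θ → lattice θ → ℝ) (hω₀ : ∀ j k, 0 < ω₀ j k)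
    (hω : ∀ j k, ω₂ j / ω₁ k ≤ ω₀ j k)
    (p₁ p₂ : Fin d → ℝ≥0∞) (p q : ℝ≥0∞)
    (hp₁ : ∀ m, 0 < p₁ m) (hp₂ : ∀ m, 0 < p₂ m) (hp : 0 < p) (hq : 0 < q)
    (hpq : ∀ m, (p₂ m)⁻¹.toReal - (p₁ m)⁻¹.toReal = p⁻¹.toReal + min 0 (q⁻¹.toReal - 1))
    (hqp₂ : ∀ m, q ≤ p₂ m) (hp₂p : ∀ m, p₂ m ≤ p)
    (A : Matrix (lattice θ) (lattice θ) ℂ) (hA : A ∈ uClass θ p q ω₀) :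
    ∃ T : MixedSeq σ θ p₁ ω₁ →L[ℂ] MixedSeq σ θ p₂ ω₂,
      -- `T` is a continuous extension of `A`, given by absolutely convergent series
      Extends A T ∧
      (∀ f j, HasSum (fun k => A j k * f k) (T f j)) ∧
      -- with norm bound
      MixedSeq.opNorm T ≤ uNorm θ p q ω₀ A ∧
      -- it is the only continuous extension when all the exponents of the domain are finite
      ((∀ m, p₁ m ≠ ∞) →
        ∀ S : MixedSeq σ θ p₁ ω₁ → MixedSeq σ θ p₂ ω₂, Continuous S → Extends A S → S = T) ∧
      -- and in every case the only one that respects dominated pointwise convergence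
      DominatedContinuous T ∧
      (∀ S : MixedSeq σ θ p₁ ω₁ → MixedSeq σ θ p₂ ω₂,
        Continuous S → Extends A S → DominatedContinuous S → S = T) := by
  have hkey := mixedNorm_tsum_enorm_le (σ := σ) hθ hω₁ hω₂ hω₀ hω hp₁ hp hq hpq hqp₂ hp₂p A
  -- An infinite sum at one `j`, times the positive weight, would make the finite mixed norm in
  -- `hkey` infinite.
  have hfin : ∀ (f : MixedSeq σ θ p₁ ω₁) (j : lattice θ), ∑' k, ‖A j k * f k‖ₑ ≠ ∞ := by
    intro f j htop
    have h := (le_mixedNorm hp₂ _ ((latticeEquiv σ hθ).symm j)).trans (hkey f.toFun)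
    simp only [Equiv.apply_symm_apply] at h
    refine ne_top_of_le_ne_top (ENNReal.mul_ne_top (ne_of_lt hA) (ne_of_lt f.2)) h ?_
    rw [htop, ENNReal.top_mul (by simpa using (hω₂ j).ne')]
  have hsum' : ∀ (f : MixedSeq σ θ p₁ ω₁) (j : lattice θ), Summable fun k => ‖A j k * f k‖ :=
    fun f j => NNReal.summable_coe.2 (ENNReal.tsum_coe_ne_top_iff_summable.1 (hfin f j))
  have hsum : ∀ (f : MixedSeq σ θ p₁ ω₁) (j : lattice θ), Summable fun k => A j k * f k :=
    fun f j => (hsum' f j).of_norm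
  have hbound : ∀ f : MixedSeq σ θ p₁ ω₁, latticeNorm σ θ p₂ ω₂ (fun j => ∑' k, A j k * f k) ≤
      uNorm θ p q ω₀ A * MixedSeq.qnorm f := by
    intro f
    refine (mixedNorm_mono p₂ fun n => ?_).trans (hkey f.toFun)
    rw [enorm_mul]
    exact mul_le_mul_left (enorm_tsum_le_tsum_enorm) _
  let T₀ : MixedSeq σ θ p₁ ω₁ →ₗ[ℂ] MixedSeq σ θ p₂ ω₂ :=
    { toFun := fun f => ⟨fun j => ∑' k, A j k * f k,
        (hbound f).trans_lt (ENNReal.mul_lt_top hA f.2)⟩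
      map_add' := fun f g => MixedSeq.ext fun j => by
        change ∑' k, A j k * (f k + g k) = ∑' k, A j k * f k + ∑' k, A j k * g k
        simp only [mul_add]
        exact (hsum f j).tsum_add (hsum g j)
      map_smul' := fun c f => MixedSeq.ext fun j => by
        change ∑' k, A j k * (c * f k) = c * ∑' k, A j k * f k
        rw [← tsum_mul_left]
        exact tsum_congr fun k => mul_left_comm _ _ _ }
  let T : MixedSeq σ θ p₁ ω₁ →L[ℂ] MixedSeq σ θ p₂ ω₂ :=
    ⟨T₀, MixedSeq.continuous_of_qnorm_le (ne_of_lt hA) T₀ hbound⟩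
  have hext : Extends A T := fun f hf => by
    refine ⟨mem_mixedSubmodule_of_finite_support hθ hp₁ ω₁ hf, fun j => ?_⟩
    refine tsum_eq_finsum (hf.subset fun k hk => ?_)
    exact right_ne_zero_of_mul hk
  have hdom : DominatedContinuous T := fun u f hu hlim j => by
    refine tendsto_tsum_of_dominated_convergence (hsum' f j)
      (fun k => (hlim k).const_mul (A j k)) (Eventually.of_forall fun n k => ?_)
    rw [norm_mul, norm_mul]
    exact mul_le_mul_of_nonneg_left (hu n k) (norm_nonneg _)
  refine ⟨T, hext, fun f j => (hsum f j).hasSum, sInf_le hbound, fun hfin₁ S hS hSA => ?_, hdom,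
    fun S _ hSA hSd => ?_⟩
  -- Both maps agree on truncations of `f`, which converge to `f` in quasi-norm; no linearity of `S`
  -- is needed.
  · refine funext fun f => MixedSeq.ext fun j => ?_
    obtain ⟨u, hu, hu', hu''⟩ := MixedSeq.exists_truncation hθ hp₁ f
    have hlim := MixedSeq.tendsto_truncation hp₁ hfin₁ hu' hu''
    have hS' := (((MixedSeq.continuous_eval hθ hp₂ hω₂ j).comp hS).tendsto f).comp hlim
    have hT' := (((MixedSeq.continuous_eval hθ hp₂ hω₂ j).comp T.continuous).tendsto f).comp hlim
    exact tendsto_nhds_unique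
      (hS'.congr fun n => MixedSeq.eq_of_finite_support hSA hext (hu n) j) hT'
  -- With infinite exponents truncations may fail to converge in quasi-norm, but they are dominated
  -- by `|f|` and converge pointwise.
  · refine funext fun f => MixedSeq.ext fun j => ?_
    obtain ⟨u, hu, hu', hu''⟩ := MixedSeq.exists_truncation hθ hp₁ f
    have hle : ∀ n k, ‖u n k‖ ≤ ‖f k‖ := fun n k => by
      rcases hu' n k with h | h <;> simp [h]
    have hlim : ∀ k, Tendsto (fun n => u n k) atTop (𝓝 (f k)) := fun k =>
      tendsto_const_nhds.congr' ((hu'' k).mono fun n hn => hn.symm)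
    exact tendsto_nhds_unique ((hSd u f hle hlim j).congr fun n =>
      MixedSeq.eq_of_finite_support hSA hext (hu n) j) (hdom u f hle hlim j)
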